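/- Let $n \ge 3$ be an integer and let $\Sigma \subset \mathbb{R}^{n+1}$ be a nonempty closed (that is, compact, without boundary), smoothly embedded $n$-dimensional hypersurface that is convex, meaning that $\Sigma$ is the boundary of an open convex subset of $\mathbb{R}^{n+1}$. Let $g$ be the Riemannian metric on $\Sigma$ induced by the flat metric of $\mathbb{R}^{n+1}$, and let $\mathrm{Ric}$ be the Ricci tensor of $g$ (with the sign for which round spheres have positive Ricci curvature). If $$\mathrm{Ric} = (n-1)\, g$$ at every point of $\Sigma$, then $(\Sigma, g)$ is isometric to the round unit sphere $\mathbb{S}^n \subset \mathbb{R}^{n+1}$ with its standard metric $\sigma$: there is a smooth diffeomorphism $F : \Sigma \to \mathbb{S}^n$ with $F^*\sigma = g$. -/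

import Mathlib

open scoped Manifold ContDiff

noncomputable section

namespace HypersurfaceRigidity

/-- The Euclidean space `ℝᵈ` with its standard inner product. -/
abbrev Eucl (d : ℕ) := EuclideanSpace ℝ (Fin d)

/-- A field of bilinear forms on the tangent spaces of an `n`-dimensional manifold. -/
abbrev BilinField (n : ℕ) (M : Type*) [TopologicalSpace M] [ChartedSpace (Eucl n) M] :=
  ∀ x : M, LinearMap.BilinForm ℝ (TangentSpace (𝓡 n) x)

/-- The metric induced by a map `f : M → ℝᵈ`: the pullback `f^* ⟨·,·⟩` of the flat metric,
`(v, w) ↦ ⟨df_x v, df_x w⟩`. -/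
def inducedMetric {n d : ℕ} {M : Type*} [TopologicalSpace M] [ChartedSpace (Eucl n) M]
    (f : M → Eucl d) : BilinField n M := fun x =>
  let df : TangentSpace (𝓡 n) x →L[ℝ] Eucl d := mfderiv (𝓡 n) (𝓡 d) f x
  (innerₗ (Eucl d)).compl₁₂ df.toLinearMap df.toLinearMap

section Coordinates

variable {n : ℕ}

/-- The partial derivative `∂ᵢ u` at `y`. -/
def pderiv (i : Fin n) (u : Eucl n → ℝ) (y : Eucl n) : ℝ :=
  fderiv ℝ u y (EuclideanSpace.single i 1)

/-- The Christoffel symbols `Γᵏᵢⱼ = ½ ∑ₗ gᵏˡ (∂ᵢ gⱼₗ + ∂ⱼ gᵢₗ - ∂ₗ gᵢⱼ)` of a metric with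
coefficient matrix `G` in coordinates. -/
def christoffel (G : Eucl n → Matrix (Fin n) (Fin n) ℝ) (k i j : Fin n) (y : Eucl n) : ℝ :=
  (1 / 2) * ∑ l, (G y)⁻¹ k l *
    (pderiv i (fun z => G z j l) y + pderiv j (fun z => G z i l) y
      - pderiv l (fun z => G z i j) y)

/-- The components `R_{ijk}^l` of the Riemann tensor, `R(∂ᵢ, ∂ⱼ)∂ₖ = ∑ₗ R_{ijk}^l ∂ₗ`, with the
sign convention `R(X, Y)Z = ∇²_{Y,X} Z - ∇²_{X,Y} Z`. -/
def riemannCoord (G : Eucl n → Matrix (Fin n) (Fin n) ℝ) (i j k l : Fin n) (y : Eucl n) : ℝ :=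
  pderiv j (christoffel G l i k) y - pderiv i (christoffel G l j k) y
    + ∑ m, (christoffel G m i k y * christoffel G l j m y
        - christoffel G m j k y * christoffel G l i m y)

/-- The components of the Ricci tensor `Ricᵢⱼ = g^{pq} Riem_{ipjq} = ∑ₚ R_{ipj}^p`; with this
convention the Ricci tensor of a round sphere is positive. -/
def ricciCoord (G : Eucl n → Matrix (Fin n) (Fin n) ℝ) (i j : Fin n) (y : Eucl n) : ℝ :=
  ∑ p, riemannCoord G i p j p y

end Coordinates

section Manifold

variable {n : ℕ} {M : Type*} [TopologicalSpace M] [ChartedSpace (Eucl n) M]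

/-- The coefficients `gᵢⱼ(y) = g(∂ᵢ, ∂ⱼ)` of `g` in the chart around `x₀`, as functions on
the target of that chart. -/
def metricCoord (g : BilinField n M) (x₀ : M) (y : Eucl n) : Matrix (Fin n) (Fin n) ℝ :=
  Matrix.of fun i j =>
    g ((extChartAt (𝓡 n) x₀).symm y)
      (mfderiv (𝓡 n) (𝓡 n) (extChartAt (𝓡 n) x₀).symm y (EuclideanSpace.single i (1 : ℝ)))
      (mfderiv (𝓡 n) (𝓡 n) (extChartAt (𝓡 n) x₀).symm y (EuclideanSpace.single j (1 : ℝ)))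

/-- The Ricci tensor of `g` at `x` on the tangent vectors `v` and `w`, computed in the chart
around `x`. The components of `v` are those of its image under the differential of the chart. -/
def ricci (g : BilinField n M) (x : M) (v w : TangentSpace (𝓡 n) x) : ℝ :=
  let e := extChartAt (𝓡 n) x
  let v' : Eucl n := mfderiv (𝓡 n) (𝓡 n) e x v
  let w' : Eucl n := mfderiv (𝓡 n) (𝓡 n) e x w
  ∑ i, ∑ j, ricciCoord (metricCoord g x) i j (e x) * v' i * w' j

/-- `(M, g)` and `(N, h)` are isometric: there is a smooth diffeomorphism `F` with
`F^* h = g`. -/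
def RiemannianIsometric {N : Type*} [TopologicalSpace N] [ChartedSpace (Eucl n) N]
    (g : BilinField n M) (h : BilinField n N) : Prop :=
  ∃ F : M ≃ₘ^∞⟮𝓡 n, 𝓡 n⟯ N, ∀ (x : M) (v w : TangentSpace (𝓡 n) x),
    h (F x) (mfderiv (𝓡 n) (𝓡 n) F x v) (mfderiv (𝓡 n) (𝓡 n) F x w) = g x v w

end Manifold

/-- A subset of `ℝᵈ` is a convex hypersurface if it is the boundary of an open, convex set. -/
def IsConvexBoundary {d : ℕ} (S : Set (Eucl d)) : Prop :=
  ∃ Ω : Set (Eucl d), IsOpen Ω ∧ Convex ℝ Ω ∧ frontier Ω = S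

/-- The unit sphere `𝕊ⁿ` in `ℝⁿ⁺¹`. -/
abbrev unitSphere (n : ℕ) : Set (Eucl (n + 1)) := Metric.sphere 0 1

end HypersurfaceRigidity

end

open HypersurfaceRigidity

/-!
In a chart `X` of the hypersurface with unit normal `ν`, the Gauss equation turns
`Ric = (n - 1) g` into `tr(A) A - A² = (n - 1) 1` for the shape operator `A`. Two distinct
principal curvatures would sum to `tr A`, so that the others sum to `0`; as all of them have the
sign of `tr A` and `n ≥ 3`, this is impossible. Hence `A = s` with `s = ±1`, and the unit sphere
around `X + s ν` osculates the hypersurface to second order. This centre is unique and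
has zero derivative, so a connected hypersurface lies in a single unit sphere. By the inverse
function theorem it is open in that sphere; being closed, it is the whole sphere.

The boundary of a bounded open convex set is connected, being homeomorphic to a sphere.
-/

namespace HypersurfaceRigidity

open Filter Matrix Metric
open scoped Topology

section PartialDerivatives

variable {n : ℕ} {V : Type*} [NormedAddCommGroup V] [NormedSpace ℝ V]
  {X Y : Eucl n → V} {y : Eucl n}

/-- The partial derivative `∂ᵢ X` of a vector-valued map; for real-valued maps it is `pderiv`. -/
noncomputable def partialDeriv (i : Fin n) (X : Eucl n → V) (y : Eucl n) : V :=
  fderiv ℝ X y (EuclideanSpace.single i 1)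

lemma pderiv_eq_partialDeriv (i : Fin n) (u : Eucl n → ℝ) : pderiv i u = partialDeriv i u := rfl

lemma contDiffAt_partialDeriv {k m : WithTop ℕ∞} (hX : ContDiffAt ℝ m X y) (hk : k + 1 ≤ m)
    (i : Fin n) : ContDiffAt ℝ k (partialDeriv i X) y :=
  (hX.fderiv_right hk).clm_apply contDiffAt_const

lemma partialDeriv_congr (h : X =ᶠ[𝓝 y] Y) (i : Fin n) :
    partialDeriv i X y = partialDeriv i Y y := by
  simp only [partialDeriv, h.fderiv_eq]

lemma partialDeriv_const (i : Fin n) (v : V) (y : Eucl n) :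
    partialDeriv i (fun _ => v) y = 0 := by
  simp [partialDeriv]

lemma partialDeriv_add (hX : DifferentiableAt ℝ X y) (hY : DifferentiableAt ℝ Y y) (i : Fin n) :
    partialDeriv i (fun z => X z + Y z) y = partialDeriv i X y + partialDeriv i Y y := by
  simp [partialDeriv, fderiv_fun_add hX hY]

lemma partialDeriv_sub (hX : DifferentiableAt ℝ X y) (hY : DifferentiableAt ℝ Y y) (i : Fin n) :
    partialDeriv i (fun z => X z - Y z) y = partialDeriv i X y - partialDeriv i Y y := by
  simp [partialDeriv, fderiv_fun_sub hX hY]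

lemma partialDeriv_sum {ι : Type*} {s : Finset ι} {X : ι → Eucl n → V}
    (hX : ∀ k ∈ s, DifferentiableAt ℝ (X k) y) (i : Fin n) :
    partialDeriv i (fun z => ∑ k ∈ s, X k z) y = ∑ k ∈ s, partialDeriv i (X k) y := by
  simp [partialDeriv, fderiv_fun_sum hX]

lemma partialDeriv_smul {u : Eucl n → ℝ} (hu : DifferentiableAt ℝ u y)
    (hX : DifferentiableAt ℝ X y) (i : Fin n) :
    partialDeriv i (fun z => u z • X z) y = u y • partialDeriv i X y + pderiv i u y • X y := by
  simp [partialDeriv, pderiv, fderiv_fun_smul hu hX]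

lemma partialDeriv_inner {W : Type*} [NormedAddCommGroup W] [InnerProductSpace ℝ W]
    {X Y : Eucl n → W} (hX : DifferentiableAt ℝ X y) (hY : DifferentiableAt ℝ Y y) (i : Fin n) :
    partialDeriv i (fun z => inner ℝ (X z) (Y z)) y
      = inner ℝ (X y) (partialDeriv i Y y) + inner ℝ (partialDeriv i X y) (Y y) :=
  fderiv_inner_apply ℝ hX hY _

lemma partialDeriv_partialDeriv (hX : DifferentiableAt ℝ (fderiv ℝ X) y) (i j : Fin n) :
    partialDeriv j (partialDeriv i X) y
      = fderiv ℝ (fderiv ℝ X) y (EuclideanSpace.single j 1) (EuclideanSpace.single i 1) := by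
  change fderiv ℝ (fun z => fderiv ℝ X z (EuclideanSpace.single i 1)) y _ = _
  simp [fderiv_clm_apply hX (differentiableAt_const _)]

lemma partialDeriv_comm (hX : ContDiffAt ℝ 2 X y) (i j : Fin n) :
    partialDeriv i (partialDeriv j X) y = partialDeriv j (partialDeriv i X) y := by
  have hd : DifferentiableAt ℝ (fderiv ℝ X) y :=
    (hX.fderiv_right (m := 1) (by norm_num)).differentiableAt one_ne_zero
  rw [partialDeriv_partialDeriv hd, partialDeriv_partialDeriv hd,
    (hX.isSymmSndFDerivAt (by simp)).eq]

lemma continuousLinearMap_eq_zero_iff_single (L : Eucl n →L[ℝ] V) :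
    L = 0 ↔ ∀ i, L (EuclideanSpace.single i 1) = 0 := by
  refine ⟨fun h i => by simp [h], fun h => ContinuousLinearMap.coe_injective ?_⟩
  exact (EuclideanSpace.basisFun (Fin n) ℝ).toBasis.ext fun i => by simpa using h i

lemma fderiv_eq_zero_iff_partialDeriv :
    fderiv ℝ X y = 0 ↔ ∀ i, partialDeriv i X y = 0 :=
  continuousLinearMap_eq_zero_iff_single _

lemma fderiv_fderiv_eq_zero_iff_partialDeriv (hX : DifferentiableAt ℝ (fderiv ℝ X) y) :
    fderiv ℝ (fderiv ℝ X) y = 0 ↔ ∀ i j, partialDeriv j (partialDeriv i X) y = 0 := by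
  simp only [continuousLinearMap_eq_zero_iff_single, partialDeriv_partialDeriv hX]
  exact forall_comm

lemma linearIndependent_partialDeriv (h : Function.Injective (fderiv ℝ X y)) :
    LinearIndependent ℝ fun i => partialDeriv i X y := by
  simpa [Function.comp_def, partialDeriv] using
    (EuclideanSpace.basisFun (Fin n) ℝ).toBasis.linearIndependent.map'
      (fderiv ℝ X y).toLinearMap (LinearMap.ker_eq_bot.2 h)

end PartialDerivatives

section Smoothness

variable {𝕜 E F G : Type*} [NontriviallyNormedField 𝕜] [NormedAddCommGroup E] [NormedSpace 𝕜 E]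
  [NormedAddCommGroup F] [NormedSpace 𝕜 F] [NormedAddCommGroup G] [NormedSpace 𝕜 G] {x : E}

lemma contDiffAt_matrix_det {m : Type*} [Fintype m] [DecidableEq m] {A : E → Matrix m m 𝕜}
    {k : WithTop ℕ∞} (hA : ∀ i j, ContDiffAt 𝕜 k (fun z => A z i j) x) :
    ContDiffAt 𝕜 k (fun z => (A z).det) x := by
  simp only [Matrix.det_apply']
  exact ContDiffAt.sum fun σ _ => contDiffAt_const.mul (contDiffAt_prod fun i _ => hA _ _)

lemma contDiffAt_matrix_inv_apply {m : Type*} [Fintype m] [DecidableEq m] {A : E → Matrix m m 𝕜}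
    {k : WithTop ℕ∞} (hA : ∀ i j, ContDiffAt 𝕜 k (fun z => A z i j) x) (hx : (A x).det ≠ 0)
    (i j : m) : ContDiffAt 𝕜 k (fun z => (A z)⁻¹ i j) x := by
  simp only [Matrix.inv_def, Matrix.smul_apply, Ring.inverse_eq_inv', smul_eq_mul,
    Matrix.adjugate_apply]
  refine ((contDiffAt_matrix_det hA).inv hx).mul (contDiffAt_matrix_det fun a b => ?_)
  simp only [Matrix.updateRow_apply]
  split_ifs
  exacts [contDiffAt_const, hA a b]

lemma fderiv_fderiv_comp_of_fderiv_eq_zero {u : F → G} {ψ : E → F}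
    (hu : ContDiffAt 𝕜 2 u (ψ x)) (hψ : ContDiffAt 𝕜 2 ψ x) (h : fderiv 𝕜 u (ψ x) = 0) :
    fderiv 𝕜 (fderiv 𝕜 (u ∘ ψ)) x
      = (fderiv 𝕜 (fderiv 𝕜 u) (ψ x)).bilinearComp (fderiv 𝕜 ψ x) (fderiv 𝕜 ψ x) := by
  have hdu : DifferentiableAt 𝕜 (fderiv 𝕜 u) (ψ x) :=
    (hu.fderiv_right (m := 1) (by norm_num)).differentiableAt one_ne_zero
  have hdψ : DifferentiableAt 𝕜 (fderiv 𝕜 ψ) x :=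
    (hψ.fderiv_right (m := 1) (by norm_num)).differentiableAt one_ne_zero
  have chain_rule :
      fderiv 𝕜 (u ∘ ψ) =ᶠ[𝓝 x] fun z => (fderiv 𝕜 u (ψ z)).comp (fderiv 𝕜 ψ z) := by
    filter_upwards [hψ.continuousAt.eventually (hu.eventually (by simp)),
      hψ.eventually (by simp)] with z huz hψz
    exact fderiv_comp z (huz.differentiableAt two_ne_zero) (hψz.differentiableAt two_ne_zero)
  have hψx := (hψ.differentiableAt two_ne_zero).hasFDerivAt
  refine chain_rule.fderiv_eq.trans <|
    ((hdu.hasFDerivAt.comp x hψx).clm_comp hdψ.hasFDerivAt).fderiv.trans ?_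
  ext v w
  simp [h]

end Smoothness

section GaussEquation

variable {n : ℕ} {V : Type*} [NormedAddCommGroup V] [InnerProductSpace ℝ V]

/-- `X : U → V` is a smooth regular parametrization over the open set `U ⊆ ℝⁿ`, and `G` is the
coefficient matrix of its first fundamental form. Nothing is required outside `U`, and `X` need
not be injective. -/
structure IsRegularParam (X : Eucl n → V) (U : Set (Eucl n))
    (G : Eucl n → Matrix (Fin n) (Fin n) ℝ) : Prop where
  isOpen : IsOpen U
  contDiffAt : ∀ y ∈ U, ContDiffAt ℝ ∞ X y
  gram : ∀ y ∈ U, ∀ i j, G y i j = inner ℝ (partialDeriv i X y) (partialDeriv j X y)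
  linearIndependent : ∀ y ∈ U, LinearIndependent ℝ fun i => partialDeriv i X y

/-- The vector-valued second fundamental form `IIᵢⱼ = ∂ⱼ∂ᵢX - ∑ₖ Γᵏᵢⱼ ∂ₖX` of a parametrization
`X` whose first fundamental form has the coefficients `G`. -/
noncomputable def secondFundForm (X : Eucl n → V) (G : Eucl n → Matrix (Fin n) (Fin n) ℝ)
    (i j : Fin n) (y : Eucl n) : V :=
  partialDeriv j (partialDeriv i X) y - ∑ k, christoffel G k i j y • partialDeriv k X y

lemma gauss_formula (X : Eucl n → V) (G : Eucl n → Matrix (Fin n) (Fin n) ℝ) (i j : Fin n)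
    (y : Eucl n) :
    partialDeriv j (partialDeriv i X) y
      = ∑ k, christoffel G k i j y • partialDeriv k X y + secondFundForm X G i j y :=
  (add_sub_cancel _ _).symm

namespace IsRegularParam

variable {X : Eucl n → V} {U : Set (Eucl n)} {G : Eucl n → Matrix (Fin n) (Fin n) ℝ}
  {y : Eucl n}

protected lemma contDiffAt_partialDeriv (P : IsRegularParam X U G) (hy : y ∈ U) (i : Fin n) :
    ContDiffAt ℝ ∞ (partialDeriv i X) y :=
  contDiffAt_partialDeriv (P.contDiffAt y hy) (by simp) i

protected lemma partialDeriv_comm (P : IsRegularParam X U G) (hy : y ∈ U) (i j : Fin n) :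
    partialDeriv i (partialDeriv j X) y = partialDeriv j (partialDeriv i X) y :=
  partialDeriv_comm ((P.contDiffAt y hy).of_le ENat.LEInfty.out) i j

lemma contDiffAt_gram (P : IsRegularParam X U G) (hy : y ∈ U) (i j : Fin n) :
    ContDiffAt ℝ ∞ (fun z => G z i j) y := by
  refine ((P.contDiffAt_partialDeriv hy i).inner ℝ
    (P.contDiffAt_partialDeriv hy j)).congr_of_eventuallyEq ?_
  filter_upwards [P.isOpen.mem_nhds hy] with z hz using P.gram z hz i j

lemma posDef (P : IsRegularParam X U G) (hy : y ∈ U) : (G y).PosDef := by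
  have hG : G y = Matrix.gram ℝ fun i => partialDeriv i X y := Matrix.ext (P.gram y hy)
  exact hG ▸ Matrix.posDef_gram_of_linearIndependent (P.linearIndependent y hy)

lemma isUnit_det (P : IsRegularParam X U G) (hy : y ∈ U) : IsUnit (G y).det :=
  (P.posDef hy).det_pos.ne'.isUnit

lemma contDiffAt_christoffel (P : IsRegularParam X U G) (hy : y ∈ U) (k i j : Fin n) :
    ContDiffAt ℝ ∞ (christoffel G k i j) y := by
  have hG (i j l : Fin n) : ContDiffAt ℝ ∞ (pderiv l fun z => G z i j) y :=
    contDiffAt_partialDeriv (P.contDiffAt_gram hy i j) (by simp) l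
  refine contDiffAt_const.mul (ContDiffAt.sum fun l _ => ?_)
  exact (contDiffAt_matrix_inv_apply (P.contDiffAt_gram hy) (P.isUnit_det hy).ne_zero k l).mul
    (((hG _ _ _).add (hG _ _ _)).sub (hG _ _ _))

lemma contDiffAt_secondFundForm (P : IsRegularParam X U G) (hy : y ∈ U) (i j : Fin n) :
    ContDiffAt ℝ ∞ (secondFundForm X G i j) y :=
  (contDiffAt_partialDeriv (P.contDiffAt_partialDeriv hy i) (by simp) j).sub
    (ContDiffAt.sum fun k _ =>
      (P.contDiffAt_christoffel hy k i j).smul (P.contDiffAt_partialDeriv hy k))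

lemma pderiv_gram (P : IsRegularParam X U G) (hy : y ∈ U) (i j k : Fin n) :
    pderiv k (fun z => G z i j) y
      = inner ℝ (partialDeriv i X y) (partialDeriv k (partialDeriv j X) y)
        + inner ℝ (partialDeriv k (partialDeriv i X) y) (partialDeriv j X y) := by
  have hG : (fun z => G z i j) =ᶠ[𝓝 y]
      fun z => inner ℝ (partialDeriv i X z) (partialDeriv j X z) := by
    filter_upwards [P.isOpen.mem_nhds hy] with z hz using P.gram z hz i j
  rw [pderiv_eq_partialDeriv, partialDeriv_congr hG, partialDeriv_inner]
  exacts [(P.contDiffAt_partialDeriv hy i).differentiableAt (by simp),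
    (P.contDiffAt_partialDeriv hy j).differentiableAt (by simp)]

lemma christoffel_comm (P : IsRegularParam X U G) (hy : y ∈ U) (k i j : Fin n) :
    christoffel G k i j y = christoffel G k j i y := by
  simp only [christoffel, P.pderiv_gram hy, real_inner_comm, P.partialDeriv_comm hy i j,
    add_comm, add_left_comm]

lemma secondFundForm_comm (P : IsRegularParam X U G) (hy : y ∈ U) (i j : Fin n) :
    secondFundForm X G i j y = secondFundForm X G j i y := by
  simp only [secondFundForm, P.partialDeriv_comm hy i j, P.christoffel_comm hy _ i j]

lemma gram_mulVec_christoffel (P : IsRegularParam X U G) (hy : y ∈ U) (i j : Fin n) :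
    G y *ᵥ (fun k => christoffel G k i j y)
      = fun l => inner ℝ (partialDeriv j (partialDeriv i X) y) (partialDeriv l X y) := by
  have koszul : (fun k => christoffel G k i j y) = (G y)⁻¹ *ᵥ
      fun l => inner ℝ (partialDeriv j (partialDeriv i X) y) (partialDeriv l X y) := by
    ext k
    simp only [christoffel, Matrix.mulVec, dotProduct, Finset.mul_sum]
    refine Finset.sum_congr rfl fun l _ => ?_
    rw [P.pderiv_gram hy, P.pderiv_gram hy, P.pderiv_gram hy, P.partialDeriv_comm hy i j,
      P.partialDeriv_comm hy i l, P.partialDeriv_comm hy j l, real_inner_comm (partialDeriv j X y)]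
    ring
  rw [koszul, Matrix.mulVec_mulVec, Matrix.mul_nonsing_inv _ (P.isUnit_det hy), Matrix.one_mulVec]

lemma inner_sum_christoffel_smul (P : IsRegularParam X U G) (hy : y ∈ U) (i j l : Fin n) :
    inner ℝ (∑ k, christoffel G k i j y • partialDeriv k X y) (partialDeriv l X y)
      = inner ℝ (partialDeriv j (partialDeriv i X) y) (partialDeriv l X y) := by
  rw [← congrFun (P.gram_mulVec_christoffel hy i j) l]
  simp only [sum_inner, real_inner_smul_left, Matrix.mulVec, dotProduct, P.gram y hy]
  simp only [real_inner_comm, mul_comm]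

lemma inner_secondFundForm_partialDeriv (P : IsRegularParam X U G) (hy : y ∈ U) (i j l : Fin n) :
    inner ℝ (secondFundForm X G i j y) (partialDeriv l X y) = 0 := by
  rw [secondFundForm, inner_sub_left, P.inner_sum_christoffel_smul hy, sub_self]

lemma inner_secondFundForm_partialDeriv_partialDeriv (P : IsRegularParam X U G) (hy : y ∈ U)
    (i j p q : Fin n) :
    inner ℝ (secondFundForm X G i j y) (partialDeriv q (partialDeriv p X) y)
      = inner ℝ (secondFundForm X G i j y) (secondFundForm X G p q y) := by
  simp [gauss_formula X G p q, inner_add_right, inner_sum, real_inner_smul_right,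
    P.inner_secondFundForm_partialDeriv hy]

lemma inner_partialDeriv_secondFundForm (P : IsRegularParam X U G) (hy : y ∈ U)
    (i j p q : Fin n) :
    inner ℝ (partialDeriv q (secondFundForm X G i j) y) (partialDeriv p X y)
      = -inner ℝ (secondFundForm X G i j y) (secondFundForm X G p q y) := by
  have hzero : (fun z => inner ℝ (secondFundForm X G i j z) (partialDeriv p X z))
      =ᶠ[𝓝 y] fun _ => (0 : ℝ) := by
    filter_upwards [P.isOpen.mem_nhds hy] with z hz
      using P.inner_secondFundForm_partialDeriv hz i j p
  have h := partialDeriv_congr hzero q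
  rw [partialDeriv_const, partialDeriv_inner
    ((P.contDiffAt_secondFundForm hy i j).differentiableAt (by simp))
    ((P.contDiffAt_partialDeriv hy p).differentiableAt (by simp)),
    P.inner_secondFundForm_partialDeriv_partialDeriv hy] at h
  linarith

lemma partialDeriv_partialDeriv_partialDeriv (P : IsRegularParam X U G) (hy : y ∈ U)
    (i j p : Fin n) :
    partialDeriv p (partialDeriv j (partialDeriv i X)) y
      = ∑ k, (christoffel G k i j y • partialDeriv p (partialDeriv k X) y
          + pderiv p (christoffel G k i j) y • partialDeriv k X y)
        + partialDeriv p (secondFundForm X G i j) y := by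
  have hΓ (k : Fin n) := (P.contDiffAt_christoffel hy k i j).differentiableAt (by simp)
  have hX (k : Fin n) := (P.contDiffAt_partialDeriv hy k).differentiableAt (by simp)
  rw [funext (gauss_formula X G i j), partialDeriv_add
    (DifferentiableAt.fun_sum fun k _ => (hΓ k).fun_smul (hX k))
    ((P.contDiffAt_secondFundForm hy i j).differentiableAt (by simp)),
    partialDeriv_sum fun k _ => (hΓ k).fun_smul (hX k)]
  simp only [partialDeriv_smul (hΓ _) (hX _)]

lemma inner_partialDeriv_partialDeriv_partialDeriv (P : IsRegularParam X U G) (hy : y ∈ U)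
    (i j p l : Fin n) :
    inner ℝ (partialDeriv p (partialDeriv j (partialDeriv i X)) y) (partialDeriv l X y)
      = (G y *ᵥ fun k => pderiv p (christoffel G k i j) y
          + ∑ m, christoffel G m i j y * christoffel G k p m y) l
        - inner ℝ (secondFundForm X G i j y) (secondFundForm X G l p y) := by
  have tangential (k : Fin n) :
      inner ℝ (partialDeriv p (partialDeriv k X) y) (partialDeriv l X y)
        = ∑ m, G y l m * christoffel G m p k y := by
    rw [P.partialDeriv_comm hy, ← congrFun (P.gram_mulVec_christoffel hy p k) l]
    rfl
  rw [P.partialDeriv_partialDeriv_partialDeriv hy, inner_add_left,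
    P.inner_partialDeriv_secondFundForm hy, ← sub_eq_add_neg]
  congr 1
  simp only [sum_inner, inner_add_left, real_inner_smul_left, tangential, Finset.sum_add_distrib,
    Matrix.mulVec, dotProduct, mul_add, Finset.mul_sum]
  rw [add_comm, Finset.sum_comm]
  refine congrArg₂ (· + ·) (Finset.sum_congr rfl fun k _ => ?_)
    (Finset.sum_congr rfl fun k _ => Finset.sum_congr rfl fun m _ => by ring)
  rw [P.gram y hy, real_inner_comm, mul_comm]

lemma gauss_equation (P : IsRegularParam X U G) (hy : y ∈ U) (i j k q : Fin n) :
    (G y *ᵥ fun l => riemannCoord G i j k l y) q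
      = inner ℝ (secondFundForm X G i k y) (secondFundForm X G q j y)
        - inner ℝ (secondFundForm X G j k y) (secondFundForm X G q i y) := by
  have third_derivatives_comm : partialDeriv j (partialDeriv k (partialDeriv i X)) y
      = partialDeriv i (partialDeriv k (partialDeriv j X)) y := by
    have comm (a : Fin n) :
        partialDeriv k (partialDeriv a X) =ᶠ[𝓝 y] partialDeriv a (partialDeriv k X) := by
      filter_upwards [P.isOpen.mem_nhds hy] with z hz using P.partialDeriv_comm hz k a
    rw [partialDeriv_congr (comm i), partialDeriv_congr (comm j)]
    exact partialDeriv_comm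
      ((P.contDiffAt_partialDeriv hy k).of_le ENat.LEInfty.out) j i
  have hR : (fun l => riemannCoord G i j k l y)
      = (fun l => pderiv j (christoffel G l i k) y
          + ∑ m, christoffel G m i k y * christoffel G l j m y)
        - fun l => pderiv i (christoffel G l j k) y
          + ∑ m, christoffel G m j k y * christoffel G l i m y := by
    ext l
    simp only [riemannCoord, Finset.sum_sub_distrib, Pi.sub_apply]
    ring
  rw [hR, Matrix.mulVec_sub, Pi.sub_apply]
  have hj := P.inner_partialDeriv_partialDeriv_partialDeriv hy i k j q
  have hi := P.inner_partialDeriv_partialDeriv_partialDeriv hy j k i q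
  rw [third_derivatives_comm] at hj
  linarith

lemma riemannCoord_eq_of_secondFundForm (P : IsRegularParam X U G) (hy : y ∈ U) {ν : V}
    (hν : ‖ν‖ = 1) {h : Matrix (Fin n) (Fin n) ℝ}
    (hII : ∀ i j, secondFundForm X G i j y = h i j • ν) (i j k l : Fin n) :
    riemannCoord G i j k l y = ∑ q, (G y)⁻¹ l q * (h i k * h q j - h j k * h q i) := by
  have hGR : G y *ᵥ (fun l => riemannCoord G i j k l y)
      = fun q => h i k * h q j - h j k * h q i := by
    ext q
    simp only [P.gauss_equation hy, hII, real_inner_smul_left, real_inner_smul_right,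
      real_inner_self_eq_norm_sq, hν]
    ring
  have := congrFun (congrArg ((G y)⁻¹ *ᵥ ·) hGR) l
  rwa [Matrix.mulVec_mulVec, Matrix.nonsing_inv_mul _ (P.isUnit_det hy), Matrix.one_mulVec] at this

lemma isSymm_of_secondFundForm (P : IsRegularParam X U G) (hy : y ∈ U) {ν : V}
    (hν : ‖ν‖ = 1) {h : Matrix (Fin n) (Fin n) ℝ}
    (hII : ∀ i j, secondFundForm X G i j y = h i j • ν) : h.IsSymm := by
  have hν0 : ν ≠ 0 := by
    rintro rfl
    simp at hν
  ext i j
  exact smul_left_injective ℝ hν0 <|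
    (hII j i).symm.trans ((P.secondFundForm_comm hy j i).trans (hII i j))

lemma ricciCoord_eq_of_secondFundForm (P : IsRegularParam X U G) (hy : y ∈ U) {ν : V}
    (hν : ‖ν‖ = 1) {h : Matrix (Fin n) (Fin n) ℝ}
    (hII : ∀ i j, secondFundForm X G i j y = h i j • ν) (i j : Fin n) :
    ricciCoord G i j y = (((G y)⁻¹ * h).trace • h - h * (G y)⁻¹ * h) i j := by
  have hsymm := (P.isSymm_of_secondFundForm hy hν hII).apply
  have hGinv (p q : Fin n) : (G y)⁻¹ p q = (G y)⁻¹ q p := by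
    simpa using ((P.posDef hy).isHermitian.inv.apply p q).symm
  simp only [ricciCoord, P.riemannCoord_eq_of_secondFundForm hy hν hII, mul_sub,
    Finset.sum_sub_distrib, Matrix.sub_apply, Matrix.smul_apply, Matrix.trace, Matrix.diag,
    Matrix.mul_apply, smul_eq_mul, Finset.sum_mul]
  congr 1 <;> refine Finset.sum_congr rfl fun p _ => Finset.sum_congr rfl fun q _ => ?_
  · ring
  · rw [hGinv, hsymm i q]
    ring

end IsRegularParam

end GaussEquation

section EinsteinShapeOperator

variable {ι : Type*} [Fintype ι] {κ : ℝ}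

-- Two different roots would be the two roots of `x ^ 2 - H * x + κ`, whose sum is `H = ∑ lₖ`, so
-- that the other `lₖ` would sum to `0`; but `H * lₖ = κ + lₖ ^ 2 > 0` gives all of them one sign.
lemma exists_forall_eq_of_sum_mul_sub_sq (hι : 3 ≤ Fintype.card ι) (hκ : 0 < κ) {l : ι → ℝ}
    (h : ∀ i, (∑ k, l k) * l i - l i ^ 2 = κ) :
    ∃ s, (Fintype.card ι - 1) * s ^ 2 = κ ∧ ∀ i, l i = s := by
  classical
  have hpos (k : ι) : 0 < (∑ k, l k) * l k := by nlinarith [h k, sq_nonneg (l k)]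
  have hconst (i j : ι) : l i = l j := by
    by_contra hne
    have hij : i ≠ j := fun e => hne (congrArg l e)
    have hvieta : l i + l j = ∑ k, l k :=
      mul_left_cancel₀ (sub_ne_zero.2 hne) (by linarith [h i, h j])
    have hrest : ∑ k ∈ Finset.univ \ {i, j}, l k = 0 := by
      have := Finset.sum_sdiff (f := l) (Finset.subset_univ {i, j})
      rw [Finset.sum_pair hij] at this
      linarith
    have hothers : (Finset.univ \ {i, j}).Nonempty := by
      rw [← Finset.card_pos, Finset.card_sdiff_of_subset (Finset.subset_univ _),
        Finset.card_pair hij, Finset.card_univ]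
      omega
    have := Finset.sum_pos (fun k _ => hpos k) hothers
    rw [← Finset.mul_sum, hrest, mul_zero] at this
    exact this.false
  obtain ⟨i⟩ : Nonempty ι := Fintype.card_pos_iff.1 (by omega)
  refine ⟨l i, ?_, fun j => hconst j i⟩
  have hsum : ∑ k, l k = Fintype.card ι * l i := by
    simp [Finset.sum_congr rfl fun k _ => hconst k i]
  rw [← h i, hsum]
  ring

variable [DecidableEq ι]

lemma eigenvalues_trace_smul_sub_sq {K : Matrix ι ι ℝ} (hK : K.IsHermitian)
    (h : K.trace • K - K * K = κ • 1) (i : ι) :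
    (∑ k, hK.eigenvalues k) * hK.eigenvalues i - hK.eigenvalues i ^ 2 = κ := by
  have hv : (hK.eigenvectorBasis i).ofLp ≠ 0 := fun h0 =>
    hK.eigenvectorBasis.toBasis.ne_zero i (by ext k; simpa using congrFun h0 k)
  have htrace : K.trace = ∑ k, hK.eigenvalues k := by simpa using hK.trace_eq_sum_eigenvalues
  have hKv := congrArg (· *ᵥ (hK.eigenvectorBasis i).ofLp) h
  simp only [Matrix.sub_mulVec, Matrix.smul_mulVec, ← Matrix.mulVec_mulVec,
    hK.mulVec_eigenvectorBasis, Matrix.mulVec_smul, Matrix.one_mulVec, htrace, smul_smul,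
    ← sub_smul] at hKv
  rw [sq]
  exact smul_left_injective ℝ hv hKv

lemma exists_eq_smul_one_of_trace_smul_sub_sq (hι : 3 ≤ Fintype.card ι) (hκ : 0 < κ)
    {K : Matrix ι ι ℝ} (hK : K.IsHermitian) (h : K.trace • K - K * K = κ • 1) :
    ∃ s : ℝ, (Fintype.card ι - 1) * s ^ 2 = κ ∧ K = s • 1 := by
  obtain ⟨s, hsκ, hs⟩ :=
    exists_forall_eq_of_sum_mul_sub_sq hι hκ (eigenvalues_trace_smul_sub_sq hK h)
  refine ⟨s, hsκ, hK.spectral_theorem.trans ?_⟩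
  have hdiag : Matrix.diagonal (RCLike.ofReal ∘ hK.eigenvalues) = s • (1 : Matrix ι ι ℝ) := by
    simp [funext hs, Matrix.smul_one_eq_diagonal]
  rw [hdiag, map_smul, map_one]

-- Reduces to `G = 1` by passing to a `G`-orthonormal frame, the columns of `C`.
open scoped MatrixOrder in
lemma exists_eq_smul_of_trace_smul_sub (hι : 3 ≤ Fintype.card ι) (hκ : 0 < κ)
    {G h : Matrix ι ι ℝ} (hG : G.PosDef) (hh : h.IsSymm)
    (hGh : (G⁻¹ * h).trace • h - h * G⁻¹ * h = κ • G) :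
    ∃ s : ℝ, (Fintype.card ι - 1) * s ^ 2 = κ ∧ h = s • G := by
  obtain ⟨C, hC⟩ : ∃ C : Matrix ι ι ℝ, G⁻¹ = C * Cᵀ := by
    obtain ⟨B, hB⟩ := CStarAlgebra.nonneg_iff_eq_star_mul_self.1 hG.inv.posSemidef.nonneg
    exact ⟨Bᵀ, by simpa [Matrix.star_eq_conjTranspose] using hB⟩
  have hdet : IsUnit G.det := hG.det_pos.ne'.isUnit
  have hCG : C * Cᵀ * G = 1 := hC ▸ Matrix.nonsing_inv_mul G hdet
  have hGC : G * (C * Cᵀ) = 1 := hC ▸ Matrix.mul_nonsing_inv G hdet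
  have hframe : Cᵀ * G * C = 1 := by
    rwa [mul_eq_one_comm, ← Matrix.mul_assoc]
  have htrace : (Cᵀ * h * C).trace = (G⁻¹ * h).trace := by
    rw [Matrix.mul_assoc, Matrix.trace_mul_comm, hC, Matrix.mul_assoc, Matrix.trace_mul_comm]
  have hsquare : Cᵀ * h * C * (Cᵀ * h * C) = Cᵀ * (h * G⁻¹ * h) * C := by
    simp only [hC, Matrix.mul_assoc]
  have heinstein : (Cᵀ * h * C).trace • (Cᵀ * h * C) - Cᵀ * h * C * (Cᵀ * h * C) = κ • 1 := by
    have := congrArg (Cᵀ * · * C) hGh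
    simp only [Matrix.mul_sub, Matrix.sub_mul, Matrix.mul_smul, Matrix.smul_mul, hframe] at this
    rwa [htrace, hsquare]
  obtain ⟨s, hsκ, hs⟩ := exists_eq_smul_one_of_trace_smul_sub_sq hι hκ
    (by simp [Matrix.IsHermitian, hh.eq, Matrix.mul_assoc]) heinstein
  refine ⟨s, hsκ, ?_⟩
  calc h = G * (C * Cᵀ) * h * (C * Cᵀ * G) := by rw [hGC, hCG, Matrix.one_mul, Matrix.mul_one]
    _ = G * C * (Cᵀ * h * C) * (Cᵀ * G) := by simp only [Matrix.mul_assoc]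
    _ = s • (G * (C * Cᵀ) * G) := by
      simp only [hs, Matrix.mul_smul, Matrix.smul_mul, Matrix.mul_one, Matrix.mul_assoc]
    _ = s • G := by rw [hGC, Matrix.one_mul]

end EinsteinShapeOperator

section UnitNormal

variable {ι V : Type*} [NormedAddCommGroup V] [InnerProductSpace ℝ V]

lemma mem_orthogonal_span_range_iff {e : ι → V} {v : V} :
    v ∈ (Submodule.span ℝ (Set.range e))ᗮ ↔ ∀ i, inner ℝ v (e i) = 0 := by
  rw [← Submodule.span_singleton_le_iff_mem, ← Submodule.isOrtho_iff_le, Submodule.isOrtho_span]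
  simp

variable [Fintype ι]

lemma exists_unit_normal (hV : Module.finrank ℝ V = Fintype.card ι + 1) (e : ι → V) :
    ∃ ν : V, ‖ν‖ = 1 ∧ ∀ i, inner ℝ ν (e i) = 0 := by
  have : FiniteDimensional ℝ V := Module.finite_of_finrank_pos (by omega)
  have hspan : Module.finrank ℝ (Submodule.span ℝ (Set.range e)) ≤ Fintype.card ι :=
    finrank_range_le_card e
  have hbot : (Submodule.span ℝ (Set.range e))ᗮ ≠ ⊥ := fun h0 => by
    have := (Submodule.span ℝ (Set.range e)).finrank_add_finrank_orthogonal
    rw [h0, finrank_bot] at this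
    omega
  obtain ⟨v, hv, hv0⟩ := Submodule.exists_mem_ne_zero_of_ne_bot hbot
  refine ⟨‖v‖⁻¹ • v, norm_smul_inv_norm hv0, mem_orthogonal_span_range_iff.1 ?_⟩
  exact Submodule.smul_mem _ _ hv

lemma eq_inner_smul_unit_normal (hV : Module.finrank ℝ V = Fintype.card ι + 1) {e : ι → V}
    (he : LinearIndependent ℝ e) {ν : V} (hν : ‖ν‖ = 1) (hνe : ∀ i, inner ℝ ν (e i) = 0)
    {v : V} (hv : ∀ i, inner ℝ v (e i) = 0) : v = (inner ℝ ν v : ℝ) • ν := by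
  have : FiniteDimensional ℝ V := Module.finite_of_finrank_pos (by omega)
  have hline : Module.finrank ℝ (Submodule.span ℝ (Set.range e))ᗮ = 1 := by
    have := (Submodule.span ℝ (Set.range e)).finrank_add_finrank_orthogonal
    rw [finrank_span_eq_card he] at this
    omega
  have hν0 : (⟨ν, mem_orthogonal_span_range_iff.2 hνe⟩ : (Submodule.span ℝ (Set.range e))ᗮ) ≠ 0 :=
    fun h0 => by simp [show ν = 0 from congrArg Subtype.val h0] at hν
  obtain ⟨a, ha⟩ := exists_smul_eq_of_finrank_eq_one hline hν0
    ⟨v, mem_orthogonal_span_range_iff.2 hv⟩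
  obtain rfl : a • ν = v := congrArg Subtype.val ha
  rw [real_inner_smul_right, real_inner_self_eq_norm_sq, hν, one_pow, mul_one]

end UnitNormal

section OsculatingCenter

variable {E F V : Type*} [NormedAddCommGroup E] [NormedSpace ℝ E] [NormedAddCommGroup F]
  [NormedSpace ℝ F] [NormedAddCommGroup V]

/-- The unit sphere centred at `c` is tangent to second order to the hypersurface `X` at the
parameter `y`: the squared distance to `c` equals `1` at `y`, and its first two derivatives vanish
there. -/
structure IsOsculatingCenter (X : E → V) (c : V) (y : E) : Prop where
  norm_sub_eq_one : ‖X y - c‖ = 1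
  fderiv_eq_zero : fderiv ℝ (fun z => ‖X z - c‖ ^ 2) y = 0
  fderiv_fderiv_eq_zero : fderiv ℝ (fderiv ℝ fun z => ‖X z - c‖ ^ 2) y = 0

lemma IsOsculatingCenter.congr {X Y : E → V} {c : V} {y : E} (h : IsOsculatingCenter X c y)
    (hXY : X =ᶠ[𝓝 y] Y) : IsOsculatingCenter Y c y := by
  have hsq : (fun z => ‖X z - c‖ ^ 2) =ᶠ[𝓝 y] fun z => ‖Y z - c‖ ^ 2 :=
    hXY.mono fun z hz => by simp only [hz]
  exact ⟨hXY.eq_of_nhds ▸ h.norm_sub_eq_one, hsq.fderiv_eq (𝕜 := ℝ) ▸ h.fderiv_eq_zero,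
    (hsq.fderiv (𝕜 := ℝ)).fderiv_eq (𝕜 := ℝ) ▸ h.fderiv_fderiv_eq_zero⟩

variable [InnerProductSpace ℝ V]

lemma IsOsculatingCenter.comp {X : F → V} {ψ : E → F} {c : V} {y : E}
    (h : IsOsculatingCenter X c (ψ y)) (hX : ContDiffAt ℝ 2 X (ψ y)) (hψ : ContDiffAt ℝ 2 ψ y) :
    IsOsculatingCenter (X ∘ ψ) c y := by
  have hu : ContDiffAt ℝ 2 (fun z => ‖X z - c‖ ^ 2) (ψ y) := (hX.sub contDiffAt_const).norm_sq ℝ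
  refine ⟨h.norm_sub_eq_one, ?_, ?_⟩
  · refine (fderiv_comp y (hu.differentiableAt two_ne_zero)
      (hψ.differentiableAt two_ne_zero)).trans ?_
    rw [h.fderiv_eq_zero, ContinuousLinearMap.zero_comp]
  · refine (fderiv_fderiv_comp_of_fderiv_eq_zero hu hψ h.fderiv_eq_zero).trans ?_
    ext v w
    simp [h.fderiv_fderiv_eq_zero]

variable {n : ℕ} {X : Eucl n → V} {y : Eucl n}

lemma partialDeriv_norm_sub_sq (hX : DifferentiableAt ℝ X y) (c : V) (i : Fin n) :
    partialDeriv i (fun z => ‖X z - c‖ ^ 2) y = 2 * inner ℝ (X y - c) (partialDeriv i X y) := by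
  have hXc : DifferentiableAt ℝ (fun z => X z - c) y := hX.sub_const c
  simp only [← real_inner_self_eq_norm_sq, partialDeriv_inner hXc hXc,
    partialDeriv_sub hX (differentiableAt_const c), partialDeriv_const, sub_zero,
    real_inner_comm (X y - c), two_mul]

lemma partialDeriv_partialDeriv_norm_sub_sq (hX : ContDiffAt ℝ 2 X y) (c : V) (i j : Fin n) :
    partialDeriv j (partialDeriv i fun z => ‖X z - c‖ ^ 2) y
      = 2 * (inner ℝ (X y - c) (partialDeriv j (partialDeriv i X) y)
        + inner ℝ (partialDeriv j X y) (partialDeriv i X y)) := by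
  have hXd := hX.differentiableAt two_ne_zero
  have hXi : DifferentiableAt ℝ (partialDeriv i X) y :=
    (contDiffAt_partialDeriv hX (k := 1) (by norm_num) i).differentiableAt one_ne_zero
  have hXc : DifferentiableAt ℝ (fun z => X z - c) y := hXd.sub_const c
  have hfirst : partialDeriv i (fun z => ‖X z - c‖ ^ 2)
      =ᶠ[𝓝 y] fun z => (2 : ℝ) • (inner ℝ (X z - c) (partialDeriv i X z) : ℝ) := by
    filter_upwards [hX.eventually (by simp)] with z hz
    simpa using partialDeriv_norm_sub_sq (hz.differentiableAt two_ne_zero) c i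
  rw [partialDeriv_congr hfirst, partialDeriv_smul (differentiableAt_const _) (hXc.inner ℝ hXi),
    partialDeriv_inner hXc hXi, partialDeriv_sub hXd (differentiableAt_const c),
    pderiv_eq_partialDeriv]
  simp [partialDeriv_const]

lemma isOsculatingCenter_iff (hX : ContDiffAt ℝ 2 X y) {c : V} :
    IsOsculatingCenter X c y ↔ ‖X y - c‖ = 1 ∧ (∀ i, inner ℝ (X y - c) (partialDeriv i X y) = 0) ∧
      ∀ i j, inner ℝ (X y - c) (partialDeriv j (partialDeriv i X) y)
        = -inner ℝ (partialDeriv i X y) (partialDeriv j X y) := by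
  have hsq : DifferentiableAt ℝ (fderiv ℝ fun z => ‖X z - c‖ ^ 2) y :=
    (((hX.sub contDiffAt_const).norm_sq ℝ).fderiv_right (m := 1) (by norm_num)).differentiableAt
      one_ne_zero
  have hdef : IsOsculatingCenter X c y ↔ ‖X y - c‖ = 1 ∧ fderiv ℝ (fun z => ‖X z - c‖ ^ 2) y = 0 ∧
      fderiv ℝ (fderiv ℝ fun z => ‖X z - c‖ ^ 2) y = 0 :=
    ⟨fun ⟨h₀, h₁, h₂⟩ => ⟨h₀, h₁, h₂⟩, fun ⟨h₀, h₁, h₂⟩ => ⟨h₀, h₁, h₂⟩⟩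
  simp only [hdef, fderiv_eq_zero_iff_partialDeriv, fderiv_fderiv_eq_zero_iff_partialDeriv hsq,
    partialDeriv_norm_sub_sq (hX.differentiableAt two_ne_zero),
    partialDeriv_partialDeriv_norm_sub_sq hX, mul_eq_zero, two_ne_zero, false_or,
    add_eq_zero_iff_eq_neg, real_inner_comm]

end OsculatingCenter

namespace IsRegularParam

variable {n : ℕ} {V : Type*} [NormedAddCommGroup V] [InnerProductSpace ℝ V]
  {X : Eucl n → V} {U : Set (Eucl n)} {G : Eucl n → Matrix (Fin n) (Fin n) ℝ} {y : Eucl n}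

protected lemma isOsculatingCenter_iff (P : IsRegularParam X U G) (hy : y ∈ U) {c : V} :
    IsOsculatingCenter X c y ↔ ‖X y - c‖ = 1 ∧ (∀ i, inner ℝ (X y - c) (partialDeriv i X y) = 0) ∧
      ∀ i j, inner ℝ (X y - c) (secondFundForm X G i j y) = -G y i j := by
  rw [HypersurfaceRigidity.isOsculatingCenter_iff ((P.contDiffAt y hy).of_le ENat.LEInfty.out)]
  refine and_congr_right fun _ => and_congr_right fun h => ?_
  simp [gauss_formula X G, inner_add_right, inner_sum, real_inner_smul_right, h, P.gram y hy]

lemma secondFundForm_eq_inner_smul (P : IsRegularParam X U G) (hy : y ∈ U)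
    (hV : Module.finrank ℝ V = n + 1) {ν : V} (hν : ‖ν‖ = 1)
    (hνX : ∀ i, inner ℝ ν (partialDeriv i X y) = 0) (i j : Fin n) :
    secondFundForm X G i j y = (inner ℝ ν (secondFundForm X G i j y) : ℝ) • ν :=
  eq_inner_smul_unit_normal (by simpa using hV) (P.linearIndependent y hy) hν hνX
    (P.inner_secondFundForm_partialDeriv hy i j)

lemma exists_isOsculatingCenter (P : IsRegularParam X U G) (hV : Module.finrank ℝ V = n + 1)
    (hn : 3 ≤ n) (hy : y ∈ U) (hRic : ∀ i j, ricciCoord G i j y = ((n : ℝ) - 1) * G y i j) :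
    ∃ c, IsOsculatingCenter X c y := by
  obtain ⟨ν, hν, hνX⟩ := exists_unit_normal (by simpa using hV) fun i => partialDeriv i X y
  set h : Matrix (Fin n) (Fin n) ℝ := Matrix.of fun i j => inner ℝ ν (secondFundForm X G i j y)
  have hII (i j : Fin n) : secondFundForm X G i j y = h i j • ν :=
    P.secondFundForm_eq_inner_smul hy hV hν hνX i j
  have hn1 : (0 : ℝ) < n - 1 := sub_pos.2 (by exact_mod_cast (by omega : 1 < n))
  have heinstein : ((G y)⁻¹ * h).trace • h - h * (G y)⁻¹ * h = ((n : ℝ) - 1) • G y := by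
    ext i j
    rw [← P.ricciCoord_eq_of_secondFundForm hy hν hII, hRic, Matrix.smul_apply, smul_eq_mul]
  obtain ⟨s, hsκ, hs⟩ := exists_eq_smul_of_trace_smul_sub (by simpa using hn) hn1 (P.posDef hy)
    (P.isSymm_of_secondFundForm hy hν hII) heinstein
  have hs1 : s ^ 2 = 1 :=
    mul_left_cancel₀ hn1.ne' (by rw [mul_one]; simpa only [Fintype.card_fin] using hsκ)
  refine ⟨X y + s • ν, (P.isOsculatingCenter_iff hy).2 ⟨?_, fun i => ?_, fun i j => ?_⟩⟩
  · have : |s| = 1 := by simpa using (sq_eq_sq_iff_abs_eq_abs s 1).1 (by simpa using hs1)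
    simp [norm_smul, hν, this]
  · simp [real_inner_smul_left, hνX]
  · simp only [sub_add_cancel_left, inner_neg_left, hII, hs, Matrix.smul_apply, smul_eq_mul,
      real_inner_smul_left, real_inner_smul_right, real_inner_self_eq_norm_sq, hν]
    linear_combination (-G y i j) * hs1

lemma eq_add_smul_of_isOsculatingCenter (P : IsRegularParam X U G) (hy : y ∈ U)
    (hV : Module.finrank ℝ V = n + 1) {c : V} (hc : IsOsculatingCenter X c y) (i : Fin n) :
    c = X y + (G y i i)⁻¹ • secondFundForm X G i i y := by
  obtain ⟨hnorm, htangent, hnormal⟩ := (P.isOsculatingCenter_iff hy).1 hc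
  rw [P.secondFundForm_eq_inner_smul hy hV hnorm htangent, hnormal, smul_smul, mul_neg,
    inv_mul_cancel₀ (P.posDef hy).diag_pos.ne', neg_one_smul, neg_sub, add_sub_cancel]

variable {c : Eucl n → V}

lemma differentiableAt_osculatingCenter [NeZero n] (P : IsRegularParam X U G) (hy : y ∈ U)
    (hV : Module.finrank ℝ V = n + 1) (hc : ∀ z ∈ U, IsOsculatingCenter X (c z) z) :
    DifferentiableAt ℝ c y := by
  have hformula : (fun z => X z + (G z 0 0)⁻¹ • secondFundForm X G 0 0 z) =ᶠ[𝓝 y] c := by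
    filter_upwards [P.isOpen.mem_nhds hy] with z hz
      using (P.eq_add_smul_of_isOsculatingCenter hz hV (hc z hz) 0).symm
  refine hformula.differentiableAt_iff.1
    (DifferentiableAt.fun_add ?_ (DifferentiableAt.fun_smul ?_ ?_))
  · exact (P.contDiffAt y hy).differentiableAt (by simp)
  · exact ((P.contDiffAt_gram hy 0 0).differentiableAt (by simp)).inv (P.posDef hy).diag_pos.ne'
  · exact (P.contDiffAt_secondFundForm hy 0 0).differentiableAt (by simp)

lemma inner_partialDeriv_osculatingCenter (P : IsRegularParam X U G) (hy : y ∈ U)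
    (hcy : DifferentiableAt ℝ c y) (hc : ∀ z ∈ U, IsOsculatingCenter X (c z) z) (i j : Fin n) :
    inner ℝ (partialDeriv j c y) (partialDeriv i X y) = 0 := by
  have hX := (P.contDiffAt y hy).differentiableAt (by simp)
  have hzero : (fun z => inner ℝ (X z - c z) (partialDeriv i X z)) =ᶠ[𝓝 y] fun _ => (0 : ℝ) := by
    filter_upwards [P.isOpen.mem_nhds hy] with z hz
      using ((P.isOsculatingCenter_iff hz).1 (hc z hz)).2.1 i
  have h := partialDeriv_congr hzero j
  rw [partialDeriv_const, partialDeriv_inner (hX.fun_sub hcy)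
    ((P.contDiffAt_partialDeriv hy i).differentiableAt (by simp)),
    ((HypersurfaceRigidity.isOsculatingCenter_iff
      ((P.contDiffAt y hy).of_le ENat.LEInfty.out)).1 (hc y hy)).2.2,
    partialDeriv_sub hX hcy, inner_sub_left, real_inner_comm] at h
  linarith

lemma inner_sub_partialDeriv_osculatingCenter (P : IsRegularParam X U G) (hy : y ∈ U)
    (hcy : DifferentiableAt ℝ c y) (hc : ∀ z ∈ U, IsOsculatingCenter X (c z) z) (j : Fin n) :
    inner ℝ (X y - c y) (partialDeriv j c y) = 0 := by
  have hX := (P.contDiffAt y hy).differentiableAt (by simp)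
  have hone : (fun z => inner ℝ (X z - c z) (X z - c z)) =ᶠ[𝓝 y] fun _ => (1 : ℝ) := by
    filter_upwards [P.isOpen.mem_nhds hy] with z hz
    rw [real_inner_self_eq_norm_sq, (hc z hz).norm_sub_eq_one, one_pow]
  have h := partialDeriv_congr hone j
  rw [partialDeriv_const, partialDeriv_inner (hX.fun_sub hcy) (hX.fun_sub hcy),
    partialDeriv_sub hX hcy, real_inner_comm (X y - c y), inner_sub_right,
    ((P.isOsculatingCenter_iff hy).1 (hc y hy)).2.1] at h
  linarith

lemma fderiv_osculatingCenter [NeZero n] (P : IsRegularParam X U G) (hy : y ∈ U)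
    (hV : Module.finrank ℝ V = n + 1) (hc : ∀ z ∈ U, IsOsculatingCenter X (c z) z) :
    fderiv ℝ c y = 0 := by
  have hcy := P.differentiableAt_osculatingCenter hy hV hc
  obtain ⟨hnorm, htangent, -⟩ := (P.isOsculatingCenter_iff hy).1 (hc y hy)
  refine fderiv_eq_zero_iff_partialDeriv.2 fun j => ?_
  rw [eq_inner_smul_unit_normal (by simpa using hV) (P.linearIndependent y hy) hnorm htangent
      fun i => P.inner_partialDeriv_osculatingCenter hy hcy hc i j,
    P.inner_sub_partialDeriv_osculatingCenter hy hcy hc, zero_smul]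

end IsRegularParam

section Immersion

open Manifold

variable {𝕜 E M F N : Type*} [NontriviallyNormedField 𝕜]
  [NormedAddCommGroup E] [NormedSpace 𝕜 E] [TopologicalSpace M] [ChartedSpace E M]
  [NormedAddCommGroup F] [NormedSpace 𝕜 F] [TopologicalSpace N] [ChartedSpace F N]
  {f : M → N} {x : M} {k : ℕ∞ω}

lemma exists_eventually_leftInverse_of_isImmersionAt
    (h : IsImmersionAt 𝓘(𝕜, E) 𝓘(𝕜, F) k f x) (hk : k ≠ 0) :
    ∃ g : N → M, MDifferentiableAt 𝓘(𝕜, F) 𝓘(𝕜, E) g (f x) ∧ g ∘ f =ᶠ[𝓝 x] id := by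
  have hwritten {z : M} (hz : z ∈ h.domChart.source) :
      (h.equiv.symm (h.codChart (f z))).1 = h.domChart z := by
    have := h.writtenInCharts (show h.domChart z ∈ (h.domChart.extend 𝓘(𝕜, E)).target by
      simpa using h.domChart.map_source hz)
    rw [show h.codChart (f z) = h.equiv (h.domChart z, 0) by
      simpa [h.domChart.left_inv hz] using this, h.equiv.symm_apply_apply]
  have hx : x ∈ h.domChart.source := h.mem_domChart_source
  have hcod : MDifferentiableAt 𝓘(𝕜, F) 𝓘(𝕜, F) h.codChart (f x) :=
    (contMDiffAt_of_mem_maximalAtlas h.codChart_mem_maximalAtlas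
      h.mem_codChart_source).mdifferentiableAt hk
  have hproj : Differentiable 𝕜 fun w => (h.equiv.symm w).1 := by fun_prop
  have hdom : MDifferentiableAt 𝓘(𝕜, E) 𝓘(𝕜, E) h.domChart.symm
      (h.equiv.symm (h.codChart (f x))).1 := by
    rw [hwritten hx]
    exact (contMDiffAt_symm_of_mem_maximalAtlas h.domChart_mem_maximalAtlas
      (h.domChart.map_source hx)).mdifferentiableAt hk
  refine ⟨fun w => h.domChart.symm (h.equiv.symm (h.codChart w)).1,
    hdom.comp (f x) ((hproj _).mdifferentiableAt.comp (f x) hcod), ?_⟩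
  filter_upwards [h.domChart.open_source.mem_nhds hx] with z hz
  simp only [Function.comp_apply, hwritten hz, h.domChart.left_inv hz, id_eq]

lemma injective_mfderiv_of_isImmersionAt (h : IsImmersionAt 𝓘(𝕜, E) 𝓘(𝕜, F) k f x)
    (hk : k ≠ 0) : Function.Injective (mfderiv 𝓘(𝕜, E) 𝓘(𝕜, F) f x) := by
  obtain ⟨g, hg, hgf⟩ := exists_eventually_leftInverse_of_isImmersionAt h hk
  have hcomp := (mfderiv_comp x hg (h.contMDiffAt.mdifferentiableAt hk)).symm.trans hgf.mfderiv_eq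
  rw [mfderiv_id] at hcomp
  exact Function.LeftInverse.injective (g := mfderiv 𝓘(𝕜, F) 𝓘(𝕜, E) g (f x)) fun v =>
    DFunLike.congr_fun hcomp v

variable [IsManifold 𝓘(𝕜, E) k M] {y : E}

lemma contMDiffAt_symm_extChartAt (hy : y ∈ (extChartAt 𝓘(𝕜, E) x).target) :
    ContMDiffAt 𝓘(𝕜, E) 𝓘(𝕜, E) k (extChartAt 𝓘(𝕜, E) x).symm y :=
  (contMDiffOn_extChartAt_symm x).contMDiffAt ((isOpen_extChartAt_target x).mem_nhds hy)

lemma isInvertible_mfderiv_symm_extChartAt [IsManifold 𝓘(𝕜, E) 1 M]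
    (hy : y ∈ (extChartAt 𝓘(𝕜, E) x).target) :
    (mfderiv 𝓘(𝕜, E) 𝓘(𝕜, E) (extChartAt 𝓘(𝕜, E) x).symm y).IsInvertible := by
  simpa [mfderivWithin_univ] using isInvertible_mfderivWithin_extChartAt_symm hy

lemma contDiffAt_comp_symm_extChartAt {f : M → F} (hf : ContMDiff 𝓘(𝕜, E) 𝓘(𝕜, F) k f)
    (hy : y ∈ (extChartAt 𝓘(𝕜, E) x).target) :
    ContDiffAt 𝕜 k (f ∘ (extChartAt 𝓘(𝕜, E) x).symm) y :=
  ((hf _).comp y (contMDiffAt_symm_extChartAt hy)).contDiffAt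

lemma fderiv_comp_symm_extChartAt {f : M → F} (hf : ContMDiff 𝓘(𝕜, E) 𝓘(𝕜, F) k f) (hk : k ≠ 0)
    (hy : y ∈ (extChartAt 𝓘(𝕜, E) x).target) :
    fderiv 𝕜 (f ∘ (extChartAt 𝓘(𝕜, E) x).symm) y
      = (mfderiv 𝓘(𝕜, E) 𝓘(𝕜, F) f ((extChartAt 𝓘(𝕜, E) x).symm y)).comp
        (mfderiv 𝓘(𝕜, E) 𝓘(𝕜, E) (extChartAt 𝓘(𝕜, E) x).symm y) := by
  rw [← mfderiv_eq_fderiv]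
  exact mfderiv_comp y ((hf _).mdifferentiableAt hk)
    ((contMDiffAt_symm_extChartAt hy).mdifferentiableAt hk)

lemma injective_fderiv_comp_symm_extChartAt {f : M → F}
    (hf : IsImmersion 𝓘(𝕜, E) 𝓘(𝕜, F) k f) (hk : k ≠ 0)
    (hy : y ∈ (extChartAt 𝓘(𝕜, E) x).target) :
    Function.Injective (fderiv 𝕜 (f ∘ (extChartAt 𝓘(𝕜, E) x).symm) y) := by
  have : IsManifold 𝓘(𝕜, E) 1 M := .of_le (ENat.one_le_iff_ne_zero_withTop.2 hk)
  rw [fderiv_comp_symm_extChartAt hf.contMDiff hk hy]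
  exact (injective_mfderiv_of_isImmersionAt (hf.isImmersionAt _) hk).comp
    (isInvertible_mfderiv_symm_extChartAt hy).injective

end Immersion

section ImmersedManifold

variable {n d : ℕ} {M : Type*} [TopologicalSpace M] [ChartedSpace (Eucl n) M]

/-- The coordinate vector `∂ᵢ` at `x` of the chart around `x`. -/
noncomputable def coordVector (i : Fin n) (x : M) : TangentSpace (𝓡 n) x :=
  mfderiv (𝓡 n) (𝓡 n) (extChartAt (𝓡 n) x).symm (extChartAt (𝓡 n) x x)
    (EuclideanSpace.single i (1 : ℝ))

lemma metricCoord_extChartAt_self (g : BilinField n M) (x : M) (i j : Fin n) :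
    metricCoord g x (extChartAt (𝓡 n) x x) i j = g x (coordVector i x) (coordVector j x) := by
  have htransport {z : M} (hz : z = x) :
      g z (coordVector i x) (coordVector j x) = g x (coordVector i x) (coordVector j x) := by
    rw [hz]
  exact htransport (extChartAt_to_inv x)

variable [IsManifold (𝓡 n) ∞ M]

lemma mfderiv_extChartAt_coordVector (i : Fin n) (x : M) :
    mfderiv (𝓡 n) (𝓡 n) (extChartAt (𝓡 n) x) x (coordVector i x)
      = (EuclideanSpace.single i 1 : Eucl n) := by
  have h := mfderiv_extChartAt_comp_mfderivWithin_extChartAt_symm'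
    (mem_extChartAt_source (I := 𝓡 n) x)
  rw [ModelWithCorners.range_eq_univ, mfderivWithin_univ] at h
  exact DFunLike.congr_fun h (EuclideanSpace.single i (1 : ℝ) : Eucl n)

lemma isRegularParam_comp_symm_extChartAt {f : M → Eucl d}
    (hf : Manifold.IsImmersion (𝓡 n) (𝓡 d) ∞ f) (x : M) :
    IsRegularParam (f ∘ (extChartAt (𝓡 n) x).symm) (extChartAt (𝓡 n) x).target
      (metricCoord (inducedMetric f) x) where
  isOpen := isOpen_extChartAt_target x
  contDiffAt y hy := contDiffAt_comp_symm_extChartAt hf.contMDiff hy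
  gram y hy i j := by
    simp only [partialDeriv, fderiv_comp_symm_extChartAt hf.contMDiff (by simp) hy]
    rfl
  linearIndependent y hy :=
    linearIndependent_partialDeriv (injective_fderiv_comp_symm_extChartAt hf (by simp) hy)

lemma ricci_coordVector (g : BilinField n M) (x : M) (i j : Fin n) :
    ricci g x (coordVector i x) (coordVector j x)
      = ricciCoord (metricCoord g x) i j (extChartAt (𝓡 n) x x) := by
  simp only [ricci, mfderiv_extChartAt_coordVector]
  simp [PiLp.single_apply]

end ImmersedManifold

section LocalRigidity

section ChartIndependence

variable {E F M : Type*} [NormedAddCommGroup E] [NormedSpace ℝ E] [TopologicalSpace M]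
  [ChartedSpace E M] [IsManifold 𝓘(ℝ, E) 2 M] [NormedAddCommGroup F] [InnerProductSpace ℝ F]
  {f : M → F}

lemma IsOsculatingCenter.comp_symm_extChartAt (hf : ContMDiff 𝓘(ℝ, E) 𝓘(ℝ, F) 2 f) {c : F}
    {p : M} (h : IsOsculatingCenter (f ∘ (extChartAt 𝓘(ℝ, E) p).symm) c (extChartAt 𝓘(ℝ, E) p p))
    {x : M} (hx : p ∈ (extChartAt 𝓘(ℝ, E) x).source) :
    IsOsculatingCenter (f ∘ (extChartAt 𝓘(ℝ, E) x).symm) c (extChartAt 𝓘(ℝ, E) x p) := by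
  have hy := (extChartAt 𝓘(ℝ, E) x).map_source hx
  have hp : (extChartAt 𝓘(ℝ, E) x).symm (extChartAt 𝓘(ℝ, E) x p) = p :=
    (extChartAt 𝓘(ℝ, E) x).left_inv hx
  have hsymm := contMDiffAt_symm_extChartAt (k := 2) hy
  have htransition : ContDiffAt ℝ 2 (extChartAt 𝓘(ℝ, E) p ∘ (extChartAt 𝓘(ℝ, E) x).symm)
      (extChartAt 𝓘(ℝ, E) x p) := by
    refine (ContMDiffAt.comp _ ?_ hsymm).contDiffAt
    rw [hp]
    exact contMDiffAt_extChartAt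
  have hcoord : (extChartAt 𝓘(ℝ, E) p ∘ (extChartAt 𝓘(ℝ, E) x).symm) (extChartAt 𝓘(ℝ, E) x p)
      = extChartAt 𝓘(ℝ, E) p p := congrArg _ hp
  have hosc := IsOsculatingCenter.comp (hcoord ▸ h)
    (contDiffAt_comp_symm_extChartAt hf (hcoord ▸ mem_extChartAt_target p)) htransition
  have hsource : (extChartAt 𝓘(ℝ, E) p).source
      ∈ 𝓝 ((extChartAt 𝓘(ℝ, E) x).symm (extChartAt 𝓘(ℝ, E) x p)) := by
    rw [hp]
    exact extChartAt_source_mem_nhds p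
  refine hosc.congr ?_
  filter_upwards [hsymm.continuousAt.preimage_mem_nhds hsource] with z hz
  simp only [Function.comp_apply, (extChartAt 𝓘(ℝ, E) p).left_inv hz]

end ChartIndependence

variable {n : ℕ} {M : Type*} [TopologicalSpace M] [ChartedSpace (Eucl n) M]
  [IsManifold (𝓡 n) ∞ M] {f : M → Eucl (n + 1)}

lemma exists_isOsculatingCenter_of_ricci_eq (hn : 3 ≤ n)
    (hf : Manifold.IsImmersion (𝓡 n) (𝓡 (n + 1)) ∞ f) {x : M}
    (hRic : ∀ v w : TangentSpace (𝓡 n) x,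
      ricci (inducedMetric f) x v w = ((n : ℝ) - 1) * inducedMetric f x v w) :
    ∃ c, IsOsculatingCenter (f ∘ (extChartAt (𝓡 n) x).symm) c (extChartAt (𝓡 n) x x) :=
  (isRegularParam_comp_symm_extChartAt hf x).exists_isOsculatingCenter finrank_euclideanSpace_fin
    hn (mem_extChartAt_target x) fun i j => by
      rw [← ricci_coordVector, hRic, metricCoord_extChartAt_self]

lemma isLocallyConstant_osculatingCenter [NeZero n]
    (hf : Manifold.IsImmersion (𝓡 n) (𝓡 (n + 1)) ∞ f) {c : M → Eucl (n + 1)}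
    (hc : ∀ x, IsOsculatingCenter (f ∘ (extChartAt (𝓡 n) x).symm) (c x) (extChartAt (𝓡 n) x x)) :
    IsLocallyConstant c := by
  refine (IsLocallyConstant.iff_eventually_eq c).2 fun x => ?_
  have P := isRegularParam_comp_symm_extChartAt hf x
  have hchart (y : Eucl n) (hy : y ∈ (extChartAt (𝓡 n) x).target) :
      IsOsculatingCenter (f ∘ (extChartAt (𝓡 n) x).symm) ((c ∘ (extChartAt (𝓡 n) x).symm) y) y := by
    simpa only [(extChartAt (𝓡 n) x).right_inv hy, Function.comp_apply] using
      (hc _).comp_symm_extChartAt (hf.contMDiff.of_le ENat.LEInfty.out)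
        ((extChartAt (𝓡 n) x).map_target hy)
  have hV : Module.finrank ℝ (Eucl (n + 1)) = n + 1 := finrank_euclideanSpace_fin
  have hopen := P.isOpen.isOpen_inter_preimage_of_fderiv_eq_zero
    (fun y hy => (P.differentiableAt_osculatingCenter hy hV hchart).differentiableWithinAt)
    (fun y hy => P.fderiv_osculatingCenter hy hV hchart) {c x}
  have hnear := hopen.mem_nhds (x := extChartAt (𝓡 n) x x) ⟨mem_extChartAt_target x, by simp⟩
  filter_upwards [(continuousAt_extChartAt (I := 𝓡 n) x).preimage_mem_nhds hnear,
    extChartAt_source_mem_nhds (I := 𝓡 n) x] with p hp hps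
  exact (congrArg c ((extChartAt (𝓡 n) x).left_inv hps)).symm.trans hp.2

lemma exists_forall_norm_sub_eq_one [PreconnectedSpace M] [Nonempty M] (hn : 3 ≤ n)
    (hf : Manifold.IsImmersion (𝓡 n) (𝓡 (n + 1)) ∞ f)
    (hRic : ∀ (x : M) (v w : TangentSpace (𝓡 n) x),
      ricci (inducedMetric f) x v w = ((n : ℝ) - 1) * inducedMetric f x v w) :
    ∃ c, ∀ x, ‖f x - c‖ = 1 := by
  have : NeZero n := ⟨by omega⟩
  choose c hc using fun x => exists_isOsculatingCenter_of_ricci_eq hn hf (hRic x)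
  obtain ⟨x₀⟩ := ‹Nonempty M›
  refine ⟨c x₀, fun x => ?_⟩
  rw [(isLocallyConstant_osculatingCenter hf hc).apply_eq_of_preconnectedSpace x₀ x]
  simpa using (hc x).norm_sub_eq_one

end LocalRigidity

section SphereHypersurface

lemma eq_of_isClosed_of_isPreconnected {T : Type*} [TopologicalSpace T] {s t : Set T}
    (ht : IsPreconnected t) (hs : IsClosed s) (hst : s ⊆ t) (hne : s.Nonempty)
    (hopen : ∀ x ∈ s, s ∈ 𝓝[t] x) : s = t := by
  have : PreconnectedSpace t := Subtype.preconnectedSpace ht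
  have hclopen : IsClopen ((↑) ⁻¹' s : Set t) :=
    ⟨hs.preimage continuous_subtype_val,
      isOpen_iff_mem_nhds.2 fun x hx => preimage_coe_mem_nhds_subtype.2 (hopen x hx)⟩
  obtain ⟨x, hx⟩ := hne
  have huniv := hclopen.eq_univ ⟨⟨x, hst hx⟩, hx⟩
  exact hst.antisymm fun z hz => huniv.ge (Set.mem_univ (⟨z, hz⟩ : t))

variable {E V : Type*} [NormedAddCommGroup E] [NormedSpace ℝ E] [NormedAddCommGroup V]
  [InnerProductSpace ℝ V] {X : E → V} {X' : E →L[ℝ] V} {y : E} {c : V} {r : ℝ}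

lemma inner_eq_zero_of_eventually_norm_sub_eq (hX : HasFDerivAt X X' y)
    (hr : ∀ᶠ z in 𝓝 y, ‖X z - c‖ = r) (v : E) : inner ℝ (X y - c) (X' v) = 0 := by
  have hsq : (fun z => ‖X z - c‖ ^ 2) =ᶠ[𝓝 y] fun _ => r ^ 2 := hr.mono fun z hz => by
    simp only [hz]
  have hderiv := (hX.sub_const c).norm_sq.unique
    ((hasFDerivAt_const (r ^ 2) y).congr_of_eventuallyEq hsq)
  simpa [inner_sub_left] using DFunLike.congr_fun hderiv v

lemma injective_smulRight_add_of_inner_eq_zero {w : V} (hw : w ≠ 0)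
    (hX' : Function.Injective X') (hinner : ∀ v, inner ℝ w (X' v) = 0) :
    Function.Injective ((ContinuousLinearMap.fst ℝ ℝ E).smulRight w
      + X'.comp (ContinuousLinearMap.snd ℝ ℝ E)) := by
  refine (injective_iff_map_eq_zero _).2 fun ⟨s, v⟩ h => ?_
  replace h : s • w + X' v = 0 := by simpa using h
  have hs : s = 0 := by
    simpa [inner_add_right, real_inner_smul_right, hinner, hw] using congrArg (inner ℝ w) h
  have hv : X' v = 0 := by simpa [hs] using h
  rw [hs, hX' (hv.trans X'.map_zero.symm), Prod.mk_zero_zero]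

-- The inverse function theorem for the cone `(t, z) ↦ c + t • (X z - c)` over the hypersurface.
lemma nhdsWithin_sphere_le_map [FiniteDimensional ℝ E]
    (hEV : Module.finrank ℝ V = Module.finrank ℝ E + 1) (hX : HasStrictFDerivAt X X' y)
    (hX' : Function.Injective X') (hr : ∀ᶠ z in 𝓝 y, ‖X z - c‖ = r) (hr0 : 0 < r) :
    𝓝[sphere c r] (X y) ≤ map X (𝓝 y) := by
  have : FiniteDimensional ℝ V := Module.finite_of_finrank_pos (by omega)
  have hw : X y - c ≠ 0 := norm_pos_iff.1 (hr.self_of_nhds ▸ hr0)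
  have hderiv : HasStrictFDerivAt (fun p : ℝ × E => c + p.1 • (X p.2 - c))
      ((ContinuousLinearMap.fst ℝ ℝ E).smulRight (X y - c)
        + X'.comp (ContinuousLinearMap.snd ℝ ℝ E)) (1, y) := by
    have hXsnd : HasStrictFDerivAt (fun p : ℝ × E => X p.2 - c)
        (X'.comp (ContinuousLinearMap.snd ℝ ℝ E)) (1, y) :=
      (HasStrictFDerivAt.comp (1, y) hX hasStrictFDerivAt_snd).sub_const c
    refine ((hasStrictFDerivAt_fst.smul hXsnd).const_add c).congr_fderiv ?_
    rw [one_smul, add_comm]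
  have hsurj := (LinearMap.injective_iff_surjective_of_finrank_eq_finrank
    (by rw [Module.finrank_prod, Module.finrank_self, hEV, add_comm])).1
    (injective_smulRight_add_of_inner_eq_zero hw hX'
      (inner_eq_zero_of_eventually_norm_sub_eq hX.hasFDerivAt hr))
  have hcone := hderiv.map_nhds_eq_of_surj (LinearMap.range_eq_top.2 hsurj)
  rw [one_smul, add_sub_cancel] at hcone
  intro s hs
  refine eventually_nhdsWithin_iff.2 (hcone ▸ eventually_map.2 ?_)
  have ht : ∀ᶠ t : ℝ in 𝓝 1, 0 < t := lt_mem_nhds one_pos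
  filter_upwards [ht.prod_inl_nhds y, hr.prod_inr_nhds 1, Eventually.prod_inr_nhds hs 1]
    with ⟨t, z⟩ ht hz hzs hmem
  have ht1 : t = 1 := by
    simpa [norm_smul, abs_of_pos ht, hz, hr0.ne'] using hmem
  change c + t • (X z - c) ∈ s
  rwa [ht1, one_smul, add_sub_cancel]

lemma range_eq_sphere_of_isImmersion [FiniteDimensional ℝ E] [Nontrivial E] {M : Type*}
    [TopologicalSpace M] [Nonempty M] [ChartedSpace E M] {k : ℕ∞ω} [IsManifold 𝓘(ℝ, E) k M]
    {f : M → V} (hf : Manifold.IsImmersion 𝓘(ℝ, E) 𝓘(ℝ, V) k f) (hk : k ≠ 0)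
    (hEV : Module.finrank ℝ V = Module.finrank ℝ E + 1) (hclosed : IsClosed (Set.range f))
    (hr : ∀ x, ‖f x - c‖ = r) (hr0 : 0 < r) : Set.range f = sphere c r := by
  have hV : 1 < Module.rank ℝ V := by
    have := Module.finrank_pos (R := ℝ) (M := E)
    exact_mod_cast Module.lt_rank_of_lt_finrank (R := ℝ) (M := V) (n := 1) (by omega)
  refine eq_of_isClosed_of_isPreconnected (isPreconnected_sphere hV c r) hclosed
    (Set.range_subset_iff.2 fun x => mem_sphere_iff_norm.2 (hr x)) (Set.range_nonempty f) ?_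
  rintro - ⟨x, rfl⟩
  have hx := mem_extChartAt_target (I := 𝓘(ℝ, E)) x
  have hX := contDiffAt_comp_symm_extChartAt hf.contMDiff hx
  have hle := nhdsWithin_sphere_le_map hEV (hX.hasStrictFDerivAt hk)
    (injective_fderiv_comp_symm_extChartAt hf hk hx) (.of_forall fun z => hr _) hr0
  rw [Function.comp_apply, extChartAt_to_inv] at hle
  exact hle (mem_map.2 (univ_mem' fun _ => Set.mem_range_self _))

end SphereHypersurface

section Convex

variable {E : Type*} [NormedAddCommGroup E] [NormedSpace ℝ E] {s : Set E}

lemma isPreconnected_compl_closedBall (hE : 1 < Module.rank ℝ E) (c : E) {r : ℝ} (hr : 0 ≤ r) :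
    IsPreconnected (closedBall c r)ᶜ := by
  suffices (closedBall c r)ᶜ
      = (fun p : ℝ × E => c + p.1 • p.2) '' (Set.Ioi r ×ˢ sphere 0 1) by
    rw [this]
    exact (isPreconnected_Ioi.prod (isPreconnected_sphere hE 0 1)).image _ (by fun_prop)
  ext x
  simp only [Set.mem_compl_iff, mem_closedBall, not_le, dist_eq_norm, Set.mem_image,
    Set.mem_prod, Set.mem_Ioi, mem_sphere_zero_iff_norm, Prod.exists]
  constructor
  · intro hx
    have hx0 : x - c ≠ 0 := norm_pos_iff.1 (hr.trans_lt hx)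
    exact ⟨‖x - c‖, ‖x - c‖⁻¹ • (x - c), ⟨hx, norm_smul_inv_norm (𝕜 := ℝ) hx0⟩, by
      rw [smul_inv_smul₀ (norm_ne_zero_iff.2 hx0), add_sub_cancel]⟩
  · rintro ⟨t, u, ⟨ht, hu⟩, rfl⟩
    rw [add_sub_cancel_left, norm_smul, hu, mul_one]
    exact ht.trans_le (le_abs_self t)

lemma eq_univ_of_convex_of_compl_closedBall_subset [Nontrivial E] (hs : Convex ℝ s) {c : E} {r : ℝ}
    (h : (closedBall c r)ᶜ ⊆ s) : s = Set.univ := by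
  refine Set.eq_univ_of_forall fun z => ?_
  obtain ⟨w, hw⟩ := NormedSpace.exists_lt_norm ℝ E (r + ‖z - c‖)
  have hfar (u : E) (hu : ‖u‖ = ‖w‖) : z + u ∈ s := h <| by
    rw [Set.mem_compl_iff, mem_closedBall_iff_norm, not_le, add_sub_right_comm, add_comm]
    have := norm_sub_le_norm_add u (z - c)
    linarith
  have hmid := hs.midpoint_mem (hfar w rfl) (hfar (-w) (norm_neg w))
  rwa [← sub_eq_add_neg, midpoint_add_sub] at hmid

lemma subset_closedBall_of_frontier_subset (hE : 1 < Module.rank ℝ E) (hs : IsOpen s)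
    (hconv : Convex ℝ s) (hne : (frontier s).Nonempty) {c : E} {r : ℝ} (hr : 0 ≤ r)
    (h : frontier s ⊆ closedBall c r) : s ⊆ closedBall c r := by
  have : Nontrivial E := rank_pos_iff_nontrivial.1 (one_pos.trans hE)
  have : PreconnectedSpace ↥(closedBall c r)ᶜ :=
    Subtype.preconnectedSpace (isPreconnected_compl_closedBall hE c hr)
  have hclopen : IsClopen ((↑) ⁻¹' s : Set ↥(closedBall c r)ᶜ) :=
    isClopen_preimage_val hs (Set.disjoint_compl_right_iff_subset.2 h)
  rcases isClopen_iff.1 hclopen with hempty | huniv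
  · intro x hx
    by_contra hxc
    exact hempty.subset (show (⟨x, hxc⟩ : ↥(closedBall c r)ᶜ) ∈ _ from hx)
  · have hsub : (closedBall c r)ᶜ ⊆ s := fun x hx => huniv.ge (Set.mem_univ ⟨x, hx⟩)
    simp [eq_univ_of_convex_of_compl_closedBall_subset hconv hsub] at hne

lemma isPreconnected_frontier_of_convex (hE : 1 < Module.rank ℝ E) (hs : Convex ℝ s)
    (hne : (interior s).Nonempty) (hb : Bornology.IsBounded s) : IsPreconnected (frontier s) := by
  obtain ⟨e, -, -, he⟩ :=
    exists_homeomorph_image_interior_closure_frontier_eq_unitBall hs hne hb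
  rw [← e.isPreconnected_image, he]
  exact isPreconnected_sphere hE 0 1

lemma IsConvexBoundary.isPreconnected {d : ℕ} (hd : 2 ≤ d) {S : Set (Eucl d)}
    (h : IsConvexBoundary S) (hb : Bornology.IsBounded S) : IsPreconnected S := by
  obtain ⟨Ω, hΩ, hconv, rfl⟩ := h
  rcases (frontier Ω).eq_empty_or_nonempty with hempty | hne
  · rw [hempty]
    exact isPreconnected_empty
  have hE : 1 < Module.rank ℝ (Eucl d) := by
    exact_mod_cast Module.lt_rank_of_lt_finrank (R := ℝ) (M := Eucl d) (n := 1)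
      (by simpa using Nat.lt_of_succ_le hd)
  obtain ⟨r, hr0, hr⟩ := hb.subset_closedBall_lt 0 0
  have hΩb := isBounded_closedBall.subset
    (subset_closedBall_of_frontier_subset hE hΩ hconv hne hr0.le hr)
  refine isPreconnected_frontier_of_convex hE hconv ?_ hΩb
  rw [hΩ.interior_eq]
  exact closure_nonempty_iff.1 (hne.mono frontier_subset_closure)

end Convex

section Translation

open scoped EuclideanSpace

section InducedMetric

variable {n d : ℕ} {M N : Type*} [TopologicalSpace M] [ChartedSpace (Eucl n) M]
  [TopologicalSpace N] [ChartedSpace (Eucl n) N] {x : M}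

lemma inducedMetric_comp {f : N → Eucl d} {F : M → N}
    (hf : MDifferentiableAt (𝓡 n) (𝓡 d) f (F x)) (hF : MDifferentiableAt (𝓡 n) (𝓡 n) F x)
    (v w : TangentSpace (𝓡 n) x) :
    inducedMetric (f ∘ F) x v w = inducedMetric f (F x)
      (mfderiv (𝓡 n) (𝓡 n) F x v) (mfderiv (𝓡 n) (𝓡 n) F x w) := by
  simp only [inducedMetric, mfderiv_comp x hf hF]
  rfl

lemma inducedMetric_sub_const {f : M → Eucl d} (hf : MDifferentiableAt (𝓡 n) (𝓡 d) f x)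
    (c : Eucl d) : inducedMetric (n := n) (fun z => f z - c) x = inducedMetric f x := by
  have hc : HasMFDerivAt (𝓡 d) (𝓡 d) (fun z : Eucl d => z - c) (f x)
      (ContinuousLinearMap.id ℝ (Eucl d)) :=
    ((hasFDerivAt_id (f x)).sub_const c).hasMFDerivAt
  have hderiv : mfderiv (𝓡 n) (𝓡 d) (fun z => f z - c) x = mfderiv (𝓡 n) (𝓡 d) f x :=
    (hc.comp x hf.hasMFDerivAt).mfderiv
  ext v w
  simp only [inducedMetric, hderiv]

end InducedMetric

variable {n : ℕ} {S : Set (Eucl (n + 1))} {c : Eucl (n + 1)}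

lemma sub_mem_unitSphere (hc : S = sphere c 1) (x : S) :
    (x : Eucl (n + 1)) - c ∈ unitSphere n := by
  simpa [hc, mem_sphere_iff_norm] using x.2

lemma unitSphere_add_mem (hc : S = sphere c 1) (y : unitSphere n) :
    (y : Eucl (n + 1)) + c ∈ S := by
  simp [hc, mem_sphere_iff_norm]

variable [ChartedSpace (Eucl n) S]

lemma contMDiff_unitSphere_add_const
    (hS : Manifold.IsImmersion (𝓡 n) (𝓡 (n + 1)) ∞ (Subtype.val : S → Eucl (n + 1)))
    (hmem : ∀ y : unitSphere n, (y : Eucl (n + 1)) + c ∈ S) :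
    ContMDiff (𝓡 n) (𝓡 n) ∞ fun y : unitSphere n => (⟨y + c, hmem y⟩ : S) := by
  rw [ContMDiff.iff_comp_isImmersion hS]
  exact ⟨by fun_prop, contMDiff_coe_sphere.add contMDiff_const⟩

variable [IsManifold (𝓡 n) ∞ S]

/-- The translation `x ↦ x - c` as a diffeomorphism from the unit sphere around `c`, with any
smooth structure making it an immersed submanifold, onto the standard unit sphere. -/
def translationDiffeomorph
    (hS : Manifold.IsImmersion (𝓡 n) (𝓡 (n + 1)) ∞ (Subtype.val : S → Eucl (n + 1)))
    (hc : S = sphere c 1) : S ≃ₘ^∞⟮𝓡 n, 𝓡 n⟯ unitSphere n where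
  toFun x := ⟨x - c, sub_mem_unitSphere hc x⟩
  invFun y := ⟨y + c, unitSphere_add_mem hc y⟩
  left_inv _ := Subtype.ext (sub_add_cancel _ _)
  right_inv _ := Subtype.ext (add_sub_cancel_right _ _)
  contMDiff_toFun := (hS.contMDiff.sub contMDiff_const).codRestrict_sphere (sub_mem_unitSphere hc)
  contMDiff_invFun := contMDiff_unitSphere_add_const hS (unitSphere_add_mem hc)

lemma riemannianIsometric_unitSphere_of_eq_sphere
    (hS : Manifold.IsImmersion (𝓡 n) (𝓡 (n + 1)) ∞ (Subtype.val : S → Eucl (n + 1)))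
    (hc : S = sphere c 1) :
    RiemannianIsometric (n := n) (inducedMetric (Subtype.val : S → Eucl (n + 1)))
      (inducedMetric (Subtype.val : unitSphere n → Eucl (n + 1))) := by
  let F := translationDiffeomorph hS hc
  refine ⟨F, fun x v w => ?_⟩
  rw [← inducedMetric_comp ((contMDiff_coe_sphere (m := ∞) _).mdifferentiableAt (by simp))
    ((F.contMDiff x).mdifferentiableAt (by simp))]
  exact LinearMap.congr_fun₂
    (inducedMetric_sub_const ((hS.contMDiff x).mdifferentiableAt (by simp)) c) v w

end Translation

end HypersurfaceRigidity

theorem mainTheorem7_general (n : ℕ) (hn : 3 ≤ n) (S : Set (Eucl (n + 1)))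
    [ChartedSpace (Eucl n) S] [IsManifold (𝓡 n) ∞ S]
    (hS : Manifold.IsImmersion (𝓡 n) (𝓡 (n + 1)) ∞ (Subtype.val : S → Eucl (n + 1)))
    (hclosed : IsClosed S) (hconn : IsConnected S)
    (hRic : ∀ (x : S) (v w : TangentSpace (𝓡 n) x),
      ricci (n := n) (inducedMetric (Subtype.val : S → Eucl (n + 1))) x v w
        = ((n : ℝ) - 1) * inducedMetric (Subtype.val : S → Eucl (n + 1)) x v w) :
    RiemannianIsometric (n := n)
      (inducedMetric (Subtype.val : S → Eucl (n + 1)))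
      (inducedMetric (Subtype.val : unitSphere n → Eucl (n + 1))) := by
  have : NeZero n := ⟨by omega⟩
  have : Nonempty S := hconn.nonempty.to_subtype
  have : PreconnectedSpace S := Subtype.preconnectedSpace hconn.isPreconnected
  obtain ⟨c, hc⟩ := exists_forall_norm_sub_eq_one hn hS hRic
  have hrange : Set.range (Subtype.val : S → Eucl (n + 1)) = Metric.sphere c 1 :=
    range_eq_sphere_of_isImmersion (E := Eucl n) hS (by simp) (by simp)
      (by simpa using hclosed) hc one_pos
  exact riemannianIsometric_unitSphere_of_eq_sphere hS (Subtype.range_val.symm.trans hrange)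

theorem mainTheorem7 (n : ℕ) (hn : 3 ≤ n) (S : Set (Eucl (n + 1)))
    [ChartedSpace (Eucl n) S] [IsManifold (𝓡 n) ∞ S]
    (hS : Manifold.IsSmoothEmbedding (𝓡 n) (𝓡 (n + 1)) ∞ (Subtype.val : S → Eucl (n + 1)))
    (hne : S.Nonempty) (hclosed : IsCompact S) (hconv : IsConvexBoundary S)
    (hRic : ∀ (x : S) (v w : TangentSpace (𝓡 n) x),
      ricci (n := n) (inducedMetric (Subtype.val : S → Eucl (n + 1))) x v w
        = ((n : ℝ) - 1) * inducedMetric (Subtype.val : S → Eucl (n + 1)) x v w) :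
    RiemannianIsometric (n := n)
      (inducedMetric (Subtype.val : S → Eucl (n + 1)))
      (inducedMetric (Subtype.val : unitSphere n → Eucl (n + 1))) :=
  mainTheorem7_general n hn S hS.isImmersion hclosed.isClosed
    ⟨hne, hconv.isPreconnected (by omega) hclosed.isBounded⟩ hRic
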